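/- All graphs are finite and simple. Let $G$ be a connected, non-bipartite graph with $V(G)=\{1,\dots,n\}$ that does not have two edge-disjoint cycles of odd length connected by a path (a path with two distinct ends, one of which is its only vertex on the first cycle and the other its only vertex on the second cycle). Let $s_i$ ($1\le i\le n$) and $a_e\le b_e$ ($e\in E(G)$) be integers. Let $f_1,\dots,f_n$ be the standard basis of $\mathbb{Z}^n$ and put $v(e)=f_i+f_j$ for an edge $e=ij$. Then there exist integers $x_e$ with $a_e\le x_e\le b_e$ ($e\in E(G)$) such that $$\sum_{i=1}^n s_i f_i=\sum_{e\in E(G)} x_e\, v(e)$$ if and only if $\sum_{i=1}^n s_i$ is even and, for all disjoint sets $I,J\subset\{1,\dots,n\}$ such that the subgraph of $G$ with vertex set $I\cup J$ and edge set $\{ij\in E(G) : i\in I,\ j\in J\}$ is a (nonempty) connected graph and no connected component of $G-(I\cup J)$ is bipartite, we have $$\sum_{i\in I}s_i-\sum_{j\in J}s_j\ \le \sum_{e=ij,\ i\in I,\ j\notin I\cup J} b_e+2\sum_{e=ij,\ i,j\in I} b_e-\sum_{e=ij,\ i\notin I\cup J,\ j\in J} a_e-2\sum_{e=ij,\ i,j\in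 J} a_e .$$ -/

import Mathlib

/-- The vector `v(e) = f_i + f_j` of an edge `e = ij`, where `f_i` is the standard basis;
it is the column of the incidence matrix belonging to `e`. -/
def edgeVector {V : Type*} [DecidableEq V] (e : Sym2 V) : V → ℤ :=
  Sym2.lift ⟨fun i j => Pi.single i 1 + Pi.single j 1, fun _ _ => add_comm _ _⟩ e

/-- `G` has two edge-disjoint odd cycles `C`, `D` connected by a path `P`: the path has two
different ends, one of which is its only vertex on `C`, the other its only vertex on `D`. -/
def HasConnectedOddCycles {V : Type*} (G : SimpleGraph V) : Prop :=
  ∃ (c d u v : V) (C : G.Walk c c) (D : G.Walk d d) (P : G.Walk u v),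
    C.IsCycle ∧ Odd C.length ∧ D.IsCycle ∧ Odd D.length ∧ C.edges.Disjoint D.edges ∧
    P.IsPath ∧ u ≠ v ∧ u ∈ C.support ∧ v ∈ D.support ∧
    (∀ x ∈ P.support, x ∈ C.support → x = u) ∧
    (∀ x ∈ P.support, x ∈ D.support → x = v)

/-- The subgraph of `G` with vertex set `I ∪ J` and edge set `{ij ∈ E(G) | i ∈ I, j ∈ J}`. -/
def crossSubgraph {V : Type*} [DecidableEq V] (G : SimpleGraph V) (I J : Finset V) :
    G.Subgraph where
  verts := {x | x ∈ I ∪ J}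
  Adj x y := G.Adj x y ∧ ((x ∈ I ∧ y ∈ J) ∨ (x ∈ J ∧ y ∈ I))
  adj_sub h := h.1
  edge_vert := by
    rintro x y ⟨-, h | h⟩
    · exact Finset.mem_union_left _ h.1
    · exact Finset.mem_union_right _ h.1
  symm := ⟨fun _ _ h => ⟨h.1.symm, h.2.symm.imp And.symm And.symm⟩⟩

/-- The edges `e = ij` of `G` with `i ∈ A` and `j ∈ B` (each edge occurs once). -/
def edgesBetween {V : Type*} [Fintype V] [DecidableEq V] (G : SimpleGraph V)
    [DecidableRel G.Adj] (A B : Finset V) : Finset G.edgeSet :=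
  Finset.univ.filter fun e => ∃ i ∈ A, ∃ j ∈ B, (e : Sym2 V) = s(i, j)

/-! Pair the equation with a vector `y : V → ℝ`. Over the box a ≤ x ≤ b the pairing ∑ x_e (y_i +
y_j) is at most `boxSupport G a b y`, and for `y = signVec I J` this bound is the cut inequality.
The sum of s is even because each v(e) has coordinate sum 2.

Conversely, if no real solution exists, Hahn–Banach gives a y violating the bound. Since
`boxSupport` is additive along decompositions with no sign cancellation on any edge, a violating y
with fewest nonzero edge sums is elementary: every nonzero z conformal to y is proportional to it.
The sign vector of the places where |y| is maximal is conformal to y, so y is a positive multiple of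
some `signVec I J`. Elementarity forces the two conditions on I and J (`exists_cut_lt`).

It remains to round (`exists_integral_solution`). The hypothesis on odd cycles enters only by making
any two of them meet. In a real solution with fewest fractional edges, no nonzero kernel vector of
the incidence matrix is supported on those edges, so their cycles are odd, and a shift along one
such cycle C that kills an edge leaves a forest of fractional edges. Leaves then force integrality;
the shift changes one vertex sum by 2t, and the parity of ∑ s makes t an integer. -/

/-! ### Edge sums and the support function of the box -/

/-- The incidence matrix of `G` acting on real edge weights. -/
noncomputable def incMap {V : Type*} [Fintype V] [DecidableEq V] (G : SimpleGraph V)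
    [DecidableRel G.Adj] : (G.edgeSet → ℝ) →ₗ[ℝ] (V → ℝ) where
  toFun x v := ∑ e : G.edgeSet, x e * (edgeVector (e : Sym2 V) v : ℝ)
  map_add' x y := by ext v; simp [add_mul, Finset.sum_add_distrib]
  map_smul' c x := by ext v; simp [mul_assoc, Finset.mul_sum]

/-- The sum of the values of `y` at the two ends of `e`. -/
def edgeSum {V : Type*} [Fintype V] [DecidableEq V] (y : V → ℝ) (e : Sym2 V) : ℝ :=
  ∑ v, y v * (edgeVector e v : ℝ)

/-- The maximum of `∑ e, x e * edgeSum y e` over the box `a ≤ x ≤ b`. -/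
noncomputable def boxSupport {V : Type*} [Fintype V] [DecidableEq V] (G : SimpleGraph V)
    [DecidableRel G.Adj] (a b : G.edgeSet → ℝ) (y : V → ℝ) : ℝ :=
  ∑ e : G.edgeSet, (b e * max (edgeSum y e) 0 - a e * max (-edgeSum y e) 0)

/-- On every edge where `z` is positive (negative), so is `y`. -/
def EdgeConformal {V : Type*} [Fintype V] [DecidableEq V] (G : SimpleGraph V) (z y : V → ℝ) : Prop :=
  ∀ e : G.edgeSet, (0 < edgeSum z e → 0 < edgeSum y e) ∧ (edgeSum z e < 0 → edgeSum y e < 0)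

/-- The difference of the indicator functions of `I` and `J`. -/
def signVec {V : Type*} [DecidableEq V] (I J : Finset V) (v : V) : ℝ :=
  (if v ∈ I then 1 else 0) - (if v ∈ J then 1 else 0)

theorem signVec_of_mem_left {V : Type*} [DecidableEq V] {I J : Finset V} (h : Disjoint I J) {v : V} (hv : v ∈ I) :
    signVec I J v = 1 := by
  simp [signVec, hv, Finset.disjoint_left.mp h hv]

theorem signVec_of_mem_right {V : Type*} [DecidableEq V] {I J : Finset V} (h : Disjoint I J) {v : V} (hv : v ∈ J) :
    signVec I J v = -1 := by
  simp [signVec, hv, Finset.disjoint_right.mp h hv]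

theorem signVec_of_notMem {V : Type*} [DecidableEq V] {I J : Finset V} {v : V} (hv : v ∉ I ∪ J) : signVec I J v = 0 := by
  rw [Finset.mem_union, not_or] at hv
  simp [signVec, hv.1, hv.2]

section

variable {V : Type*} [Fintype V] [DecidableEq V]

theorem edgeSum_mk (y : V → ℝ) (i j : V) : edgeSum y s(i, j) = y i + y j := by
  simp [edgeSum, edgeVector, mul_add, Finset.sum_add_distrib, Pi.single_apply]

theorem edgeSum_sub (y z : V → ℝ) (e : Sym2 V) : edgeSum (y - z) e = edgeSum y e - edgeSum z e := by
  simp [edgeSum, sub_mul]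

theorem edgeSum_smul (c : ℝ) (y : V → ℝ) (e : Sym2 V) : edgeSum (c • y) e = c * edgeSum y e := by
  simp [edgeSum, Finset.mul_sum, mul_assoc]

theorem sum_mul_incMap (G : SimpleGraph V) [DecidableRel G.Adj] (x : G.edgeSet → ℝ) (y : V → ℝ) :
    ∑ v, incMap G x v * y v = ∑ e : G.edgeSet, x e * edgeSum y e := by
  simp only [incMap, edgeSum, LinearMap.coe_mk, AddHom.coe_mk, Finset.sum_mul, Finset.mul_sum]
  rw [Finset.sum_comm]
  exact Finset.sum_congr rfl fun e _ => Finset.sum_congr rfl fun v _ => by ring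

theorem conformal_iff (G : SimpleGraph V) (z y : V → ℝ) :
    EdgeConformal G z y ↔ ∀ i j, G.Adj i j →
      (0 < z i + z j → 0 < y i + y j) ∧ (z i + z j < 0 → y i + y j < 0) := by
  constructor
  · intro h i j hij
    simpa [edgeSum_mk] using h ⟨s(i, j), hij⟩
  · rintro h ⟨e, he⟩
    induction e with
    | h i j => simpa [edgeSum_mk] using h i j he

/-- Each summand is linear in the edge sum on either closed half-line, and on every edge both pieces
`y - c • z` and `c • z` lie in the same one. -/
theorem boxSupport_add_smul (G : SimpleGraph V) [DecidableRel G.Adj] (a b : G.edgeSet → ℝ)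
    (y z : V → ℝ) (c : ℝ) (hc : 0 ≤ c)
    (h : ∀ e : G.edgeSet, (0 ≤ edgeSum z e ∧ 0 ≤ edgeSum y e - c * edgeSum z e) ∨
      (edgeSum z e ≤ 0 ∧ edgeSum y e - c * edgeSum z e ≤ 0)) :
    boxSupport G a b y = boxSupport G a b (y - c • z) + c * boxSupport G a b z := by
  simp only [boxSupport, Finset.mul_sum, ← Finset.sum_add_distrib, edgeSum_sub, edgeSum_smul]
  refine Finset.sum_congr rfl fun e _ => ?_
  rcases h e with ⟨h1, h2⟩ | ⟨h1, h2⟩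
  · have := mul_nonneg hc h1
    rw [max_eq_left (by linarith), max_eq_right (by linarith), max_eq_left h2,
      max_eq_right (by linarith), max_eq_left h1, max_eq_right (by linarith)]
    ring
  · have := mul_nonpos_of_nonneg_of_nonpos hc h1
    rw [max_eq_right (by linarith), max_eq_left (by linarith), max_eq_right h2,
      max_eq_left (by linarith), max_eq_right h1, max_eq_left (by linarith)]
    ring

theorem boxSupport_smul (G : SimpleGraph V) [DecidableRel G.Adj] (a b : G.edgeSet → ℝ)
    (z : V → ℝ) (c : ℝ) (hc : 0 ≤ c) : boxSupport G a b (c • z) = c * boxSupport G a b z := by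
  rw [boxSupport_add_smul G a b (c • z) z c hc]
  · have : boxSupport G a b (c • z - c • z) = 0 := by
      simp [boxSupport, edgeSum]
    rw [this, zero_add]
  · intro e
    simpa [edgeSum_smul] using le_total 0 (edgeSum z e)

theorem le_boxSupport (G : SimpleGraph V) [DecidableRel G.Adj] (a b x : G.edgeSet → ℝ)
    (hx : ∀ e, a e ≤ x e ∧ x e ≤ b e) (y : V → ℝ) :
    ∑ e : G.edgeSet, x e * edgeSum y e ≤ boxSupport G a b y := by
  refine Finset.sum_le_sum fun e _ => ?_
  rcases le_total 0 (edgeSum y e) with h | h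
  · rw [max_eq_left h, max_eq_right (by linarith)]
    nlinarith [hx e]
  · rw [max_eq_right h, max_eq_left (by linarith)]
    nlinarith [hx e]

/-! ### Separation and elementary vectors -/

/-- If the box has no point in the fibre over `s`, then some `y` separates. -/
theorem exists_boxSupport_lt (G : SimpleGraph V) [DecidableRel G.Adj] (a b : G.edgeSet → ℝ)
    (hab : ∀ e, a e ≤ b e) (s : V → ℝ)
    (hs : ¬ ∃ x : G.edgeSet → ℝ, (∀ e, a e ≤ x e ∧ x e ≤ b e) ∧ incMap G x = s) :
    ∃ y : V → ℝ, boxSupport G a b y < ∑ v, s v * y v := by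
  have hcl : IsClosed (incMap G '' Set.Icc a b) :=
    (isCompact_Icc.image (LinearMap.continuous_of_finiteDimensional _)).isClosed
  have hcv : Convex ℝ (incMap G '' Set.Icc a b) := (convex_Icc a b).linear_image _
  have hn : s ∉ incMap G '' Set.Icc a b := by
    rintro ⟨x, ⟨h1, h2⟩, rfl⟩
    exact hs ⟨x, fun e => ⟨h1 e, h2 e⟩, rfl⟩
  obtain ⟨f, u, hf, hu⟩ := geometric_hahn_banach_closed_point hcv hcl hn
  have hfy : ∀ w : V → ℝ, f w = ∑ v, w v * f (Pi.single v 1) := by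
    intro w
    conv_lhs => rw [← Finset.univ_sum_single w]
    rw [map_sum]
    refine Finset.sum_congr rfl fun v _ => ?_
    rw [← smul_eq_mul, ← map_smul]
    congr 1
    ext t
    simp [Pi.single_apply]
  set y : V → ℝ := fun v => f (Pi.single v 1)
  refine ⟨y, ?_⟩
  -- The corner of the box at which the pairing with `y` attains `boxSupport G a b y`.
  set x : G.edgeSet → ℝ := fun e => if 0 ≤ edgeSum y e then b e else a e
  have hx : x ∈ Set.Icc a b := by
    constructor <;> intro e <;> simp only [x] <;> split_ifs <;> first | exact le_rfl | exact hab e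
  have h1 := hf _ ⟨x, hx, rfl⟩
  rw [hfy] at h1 hu
  rw [sum_mul_incMap G x y] at h1
  refine lt_of_eq_of_lt ?_ (h1.trans hu)
  refine Finset.sum_congr rfl fun e _ => ?_
  simp only [x]
  split_ifs with h
  · rw [max_eq_left h, max_eq_right (by linarith)]; ring
  · rw [max_eq_right (by linarith), max_eq_left (by linarith)]; ring

/-- Values at adjacent vertices are opposite, so one nonzero value spreads to all vertices, and the
sign would be a 2-colouring. -/
theorem eq_zero_of_edgeSum_eq_zero (G : SimpleGraph V) (hconn : G.Connected)
    (hnb : ¬ G.IsBipartite) (y : V → ℝ) (hy : ∀ e : G.edgeSet, edgeSum y e = 0) : y = 0 := by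
  by_contra hne
  have hadj : ∀ i j, G.Adj i j → y i + y j = 0 := fun i j h => by
    simpa [edgeSum_mk] using hy ⟨s(i, j), h⟩
  obtain ⟨u, hu⟩ := Function.ne_iff.mp hne
  have habs : ∀ w, y w ≠ 0 := by
    intro w
    obtain ⟨p⟩ := hconn.preconnected w u
    induction p with
    | nil => simpa using hu
    | cons h p ih =>
      have := hadj _ _ h
      intro h0
      exact ih hu (by linarith)
  refine hnb ⟨SimpleGraph.Coloring.mk (fun v => if 0 < y v then (0 : Fin 2) else 1) ?_⟩
  intro i j hij
  have := hadj _ _ hij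
  have hi := habs i
  rcases lt_or_gt_of_ne hi with h | h
  · simp [h.not_gt, show 0 < y j by linarith]
  · simp [h, show ¬ 0 < y j by linarith]

/-- Take `c` to be the least ratio p/q over the support of q: the multiple of q subtracted stops
exactly when the first coordinate vanishes, before any sign flips. -/
theorem exists_smul_sub_conformal {ι : Type*} [Fintype ι] (p q : ι → ℝ)
    (h : ∀ e, (0 < q e → 0 < p e) ∧ (q e < 0 → p e < 0)) (hq : ∃ e, q e ≠ 0) :
    ∃ c : ℝ, 0 < c ∧
      (∀ e, (0 ≤ q e ∧ 0 ≤ p e - c * q e) ∨ (q e ≤ 0 ∧ p e - c * q e ≤ 0)) ∧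
      (∀ e, (0 < p e - c * q e → 0 < p e) ∧ (p e - c * q e < 0 → p e < 0)) ∧
      ∃ e, p e ≠ 0 ∧ p e - c * q e = 0 := by
  classical
  obtain ⟨e₁, he₁⟩ := hq
  obtain ⟨e₀, he₀, hmin⟩ := Finset.exists_min_image (Finset.univ.filter fun e => q e ≠ 0)
    (fun e => p e / q e) ⟨e₁, by simpa using he₁⟩
  simp only [Finset.mem_filter, Finset.mem_univ, true_and] at he₀ hmin
  have hpos : ∀ e, q e ≠ 0 → 0 < p e / q e := by
    intro e he
    rcases lt_or_gt_of_ne he with h' | h'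
    · exact div_pos_of_neg_of_neg ((h e).2 h') h'
    · exact div_pos ((h e).1 h') h'
  have hc := hpos e₀ he₀
  have hsign : ∀ e, (0 < q e → 0 ≤ p e - p e₀ / q e₀ * q e) ∧
      (q e < 0 → p e - p e₀ / q e₀ * q e ≤ 0) := by
    intro e
    refine ⟨fun h' => ?_, fun h' => ?_⟩
    · have := (le_div_iff₀ h').mp (hmin e h'.ne')
      linarith
    · have := (le_div_iff_of_neg h').mp (hmin e h'.ne)
      linarith
  refine ⟨p e₀ / q e₀, hc, fun e => ?_, fun e => ?_, e₀, ?_, ?_⟩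
  · rcases lt_trichotomy (q e) 0 with h' | h' | h'
    · exact .inr ⟨h'.le, (hsign e).2 h'⟩
    · simpa [h'] using le_total 0 (p e)
    · exact .inl ⟨h'.le, (hsign e).1 h'⟩
  · rcases lt_trichotomy (q e) 0 with h' | h' | h'
    · have := (hsign e).2 h'
      exact ⟨fun _ => by linarith, fun _ => (h e).2 h'⟩
    · simp [h']
    · have := (hsign e).1 h'
      exact ⟨fun _ => (h e).1 h', fun _ => by linarith⟩
  · intro h0
    rw [h0, zero_div] at hc
    exact lt_irrefl _ hc
  · rw [div_mul_cancel₀ _ he₀, sub_self]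

/-- A separating vector may be chosen to be elementary. -/
theorem exists_elementary_boxSupport_lt (G : SimpleGraph V) [DecidableRel G.Adj]
    (hconn : G.Connected) (hnb : ¬ G.IsBipartite) (a b : G.edgeSet → ℝ) (s : V → ℝ)
    (hex : ∃ y : V → ℝ, boxSupport G a b y < ∑ v, s v * y v) :
    ∃ y : V → ℝ, boxSupport G a b y < ∑ v, s v * y v ∧
      ∀ z, EdgeConformal G z y → z ≠ 0 → ∃ c : ℝ, 0 < c ∧ y = c • z := by
  obtain ⟨y, hy, hmin⟩ := WellFounded.has_min
    (measure fun y : V → ℝ => (Finset.univ.filter fun e : G.edgeSet => edgeSum y e ≠ 0).card).wf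
    {y | boxSupport G a b y < ∑ v, s v * y v} hex
  -- The remainder `y - c • z` has fewer nonzero edge sums, so by minimality it does not separate;
  -- by additivity `z` must.
  have key : ∀ z, EdgeConformal G z y → z ≠ 0 → boxSupport G a b z < ∑ v, s v * z v ∧
      ∃ c : ℝ, 0 < c ∧ EdgeConformal G (y - c • z) y ∧
        ¬ boxSupport G a b (y - c • z) < ∑ v, s v * (y - c • z) v := by
    intro z hz hz0
    obtain ⟨c, hc, h1, h2, e₀, he₀, he₀'⟩ := exists_smul_sub_conformal
      (fun e : G.edgeSet => edgeSum y e) (fun e : G.edgeSet => edgeSum z e) hz (by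
        by_contra! hcon
        exact hz0 (eq_zero_of_edgeSum_eq_zero G hconn hnb z hcon))
    have hconf : EdgeConformal G (y - c • z) y := by
      intro e
      simpa only [edgeSum_sub, edgeSum_smul] using h2 e
    have hnot : ¬ boxSupport G a b (y - c • z) < ∑ v, s v * (y - c • z) v := by
      intro hlt
      refine hmin _ hlt (Finset.card_lt_card ?_)
      refine (Finset.ssubset_iff_of_subset ?_).mpr ⟨e₀, by simpa using he₀, ?_⟩
      · intro e he
        simp only [Finset.mem_filter, Finset.mem_univ, true_and] at he ⊢
        rcases lt_or_gt_of_ne he with h | h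
        · exact ((hconf e).2 h).ne
        · exact ((hconf e).1 h).ne'
      · simpa [edgeSum_sub, edgeSum_smul] using he₀'
    refine ⟨?_, c, hc, hconf, hnot⟩
    have hy' : boxSupport G a b y < ∑ v, s v * y v := hy
    rw [boxSupport_add_smul G a b y z c hc.le h1] at hy'
    have hsum : ∑ v, s v * (y - c • z) v = ∑ v, s v * y v - c * ∑ v, s v * z v := by
      rw [Finset.mul_sum, ← Finset.sum_sub_distrib]
      exact Finset.sum_congr rfl fun v _ => by simp; ring
    rw [hsum] at hnot
    exact lt_of_mul_lt_mul_left (by linarith) hc.le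
  refine ⟨y, hy, fun z hz hz0 => ?_⟩
  obtain ⟨-, c, hc, hconf, hnot⟩ := key z hz hz0
  refine ⟨c, hc, ?_⟩
  by_contra hne
  -- A nonzero remainder is itself conformal to `y`, so `key` would make it separating.
  exact hnot (key _ hconf (sub_ne_zero.mpr hne)).1

/-! ### Sign vectors of maximal modulus -/

/-- An edge with an end of value m has nonnegative sum under y, and the sum vanishes only if the
other end has value -m; symmetrically at -m. -/
theorem conformal_signVec_max (G : SimpleGraph V) (y : V → ℝ) (m : ℝ) (hm : ∀ v, |y v| ≤ m) :
    EdgeConformal G (signVec (Finset.univ.filter fun v => y v = m)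
      (Finset.univ.filter fun v => y v = -m)) y := by
  rw [conformal_iff]
  intro i j _
  have hi := abs_le.mp (hm i)
  have hj := abs_le.mp (hm j)
  simp only [signVec, Finset.mem_filter, Finset.mem_univ, true_and]
  have lt1 : ∀ v, y v ≠ -m → -m < y v := fun v h =>
    lt_of_le_of_ne (abs_le.mp (hm v)).1 (Ne.symm h)
  have lt2 : ∀ v, y v ≠ m → y v < m := fun v h => lt_of_le_of_ne (abs_le.mp (hm v)).2 h
  constructor
  · intro h
    by_cases h1 : y i = m <;> by_cases h2 : y j = m <;> by_cases h3 : y i = -m <;>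
      by_cases h4 : y j = -m <;> simp only [h1, h2, h3, h4, if_true, if_false] at h <;>
      first
      | (exfalso; norm_num at h; done)
      | (have := lt1 i; have := lt1 j; grind)
  · intro h
    by_cases h1 : y i = m <;> by_cases h2 : y j = m <;> by_cases h3 : y i = -m <;>
      by_cases h4 : y j = -m <;> simp only [h1, h2, h3, h4, if_true, if_false] at h <;>
      first
      | (exfalso; norm_num at h; done)
      | (have := lt2 i; have := lt2 j; grind)

/-- Restrict the sign vector to one component of the cross subgraph. An edge leaving that component
ends outside I ∪ J or on the same side, so the restriction is conformal; being proportional to the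
whole, it must be the whole. -/
theorem crossSubgraph_connected_of_elementary (G : SimpleGraph V) (I J : Finset V)
    (hIJ : Disjoint I J) (hne : (I ∪ J).Nonempty)
    (h : ∀ z, EdgeConformal G z (signVec I J) → z ≠ 0 → ∃ c : ℝ, 0 < c ∧ signVec I J = c • z) :
    (crossSubgraph G I J).Connected := by
  classical
  have hne0 : ∀ v ∈ I ∪ J, signVec I J v ≠ 0 := by
    intro v hv
    rcases Finset.mem_union.mp hv with h | h
    · simp [signVec_of_mem_left hIJ h]
    · simp [signVec_of_mem_right hIJ h]
  obtain ⟨u₀, hu₀⟩ := hne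
  rw [SimpleGraph.Subgraph.connected_iff']
  refine (SimpleGraph.connected_iff_exists_forall_reachable _).mpr ⟨⟨u₀, hu₀⟩, ?_⟩
  set S : V → Prop := fun v => ∃ hv : v ∈ I ∪ J,
    (crossSubgraph G I J).coe.Reachable ⟨u₀, hu₀⟩ ⟨v, hv⟩ with hS
  have hclosed : ∀ i j, G.Adj i j → S i → ((i ∈ I ∧ j ∈ J) ∨ (i ∈ J ∧ j ∈ I)) → S j := by
    rintro i j hij ⟨hi, hr⟩ hc
    have hj : j ∈ I ∪ J := by
      rcases hc with hc | hc
      · exact Finset.mem_union_right _ hc.2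
      · exact Finset.mem_union_left _ hc.2
    refine ⟨hj, hr.trans (SimpleGraph.Adj.reachable ?_)⟩
    exact ⟨hij, hc⟩
  have half : ∀ i j, G.Adj i j → S i → ¬ S j →
      (0 < signVec I J i → 0 < signVec I J i + signVec I J j) ∧
      (signVec I J i < 0 → signVec I J i + signVec I J j < 0) := by
    intro i j hij hi hj
    obtain ⟨hi', -⟩ := id hi
    rcases Finset.mem_union.mp hi' with h1 | h1
    · have : j ∉ J := fun h2 => hj (hclosed i j hij hi (.inl ⟨h1, h2⟩))
      rw [signVec_of_mem_left hIJ h1]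
      by_cases h3 : j ∈ I <;> simp [signVec, this, h3]
    · have : j ∉ I := fun h2 => hj (hclosed i j hij hi (.inr ⟨h1, h2⟩))
      rw [signVec_of_mem_right hIJ h1]
      by_cases h3 : j ∈ J <;> simp [signVec, this, h3]
  obtain ⟨c, hc, hyz⟩ := h (fun v => if S v then signVec I J v else 0) (by
      rw [conformal_iff]
      intro i j hij
      by_cases hi : S i <;> by_cases hj : S j
      · simp [hi, hj]
      · simpa [hi, hj] using half i j hij hi hj
      · simpa [hi, hj, add_comm] using half j i hij.symm hj hi
      · simp [hi, hj]) (by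
      intro h0
      have := congrFun h0 u₀
      have hSu : S u₀ := ⟨hu₀, SimpleGraph.Reachable.refl _⟩
      simp only [hSu, if_true] at this
      exact hne0 u₀ hu₀ this)
  rintro ⟨v, hv⟩
  by_contra hcon
  have hSv : ¬ S v := fun ⟨_, h⟩ => hcon h
  have := congrFun hyz v
  simp only [Pi.smul_apply, hSv, if_false, smul_zero] at this
  exact hne0 v hv this

/-- Add to the sign vector a ±1 colouring `k` of a bipartite component. Inside the component edge
sums stay 0; an edge leaving it ends in I ∪ J, where 1 becomes 0 or 2 and -1 becomes 0 or -2. The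
result is conformal but not proportional. -/
theorem component_not_bipartite_of_elementary (G : SimpleGraph V) (I J : Finset V)
    (hIJ : Disjoint I J) (hne : (I ∪ J).Nonempty)
    (h : ∀ z, EdgeConformal G z (signVec I J) → z ≠ 0 → ∃ c : ℝ, 0 < c ∧ signVec I J = c • z)
    (c : (G.induce {x | x ∉ I ∪ J}).ConnectedComponent) : ¬ c.toSimpleGraph.IsBipartite := by
  classical
  rintro ⟨C⟩
  set k : V → ℝ := fun v => if hv : ∃ h : v ∉ I ∪ J, (⟨v, h⟩ : {x | x ∉ I ∪ J}) ∈ c.supp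
    then (if C ⟨⟨v, hv.1⟩, hv.2⟩ = 0 then 1 else -1) else 0 with hk
  set K : V → Prop := fun v => ∃ h : v ∉ I ∪ J, (⟨v, h⟩ : {x | x ∉ I ∪ J}) ∈ c.supp with hK
  have hk1 : ∀ v, K v → (k v = 1 ∨ k v = -1) := by
    intro v hv
    simp only [hk]
    rw [dif_pos hv]
    split_ifs <;> simp
  have hk0 : ∀ v, ¬ K v → k v = 0 := fun v hv => by simp only [hk]; rw [dif_neg hv]
  have hkk : ∀ i j, G.Adj i j → K i → K j → k i + k j = 0 := by
    intro i j hij hi hj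
    have hne : C ⟨⟨i, hi.1⟩, hi.2⟩ ≠ C ⟨⟨j, hj.1⟩, hj.2⟩ := C.valid (by exact hij)
    simp only [hk]
    rw [dif_pos hi, dif_pos hj]
    by_cases h1 : C ⟨⟨i, hi.1⟩, hi.2⟩ = 0 <;> by_cases h2 : C ⟨⟨j, hj.1⟩, hj.2⟩ = 0
    · exact absurd (h1.trans h2.symm) hne
    · simp [h1, h2]
    · simp [h1, h2]
    · exact absurd (by omega) hne
  have hout : ∀ i j, G.Adj i j → K i → ¬ K j → j ∈ I ∪ J := by
    intro i j hij hi hj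
    by_contra hj'
    refine hj ⟨hj', ?_⟩
    have hadj : (G.induce {x | x ∉ I ∪ J}).Adj ⟨i, hi.1⟩ ⟨j, hj'⟩ := hij
    have := hi.2
    rw [SimpleGraph.ConnectedComponent.mem_supp_iff] at this ⊢
    rw [← this]
    exact (SimpleGraph.ConnectedComponent.sound hadj.reachable).symm
  have half : ∀ i j, G.Adj i j → K i → ¬ K j →
      (0 < signVec I J i + k i + (signVec I J j + k j) → 0 < signVec I J i + signVec I J j) ∧
      (signVec I J i + k i + (signVec I J j + k j) < 0 → signVec I J i + signVec I J j < 0) := by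
    intro i j hij hi hj
    rw [signVec_of_notMem hi.1, hk0 j hj]
    rcases Finset.mem_union.mp (hout i j hij hi hj) with h1 | h1
    · rw [signVec_of_mem_left hIJ h1]
      rcases hk1 i hi with h2 | h2 <;> rw [h2] <;> norm_num
    · rw [signVec_of_mem_right hIJ h1]
      rcases hk1 i hi with h2 | h2 <;> rw [h2] <;> norm_num
  obtain ⟨d, hd, hyz⟩ := h (fun v => signVec I J v + k v) (by
      rw [conformal_iff]
      intro i j hij
      by_cases hi : K i <;> by_cases hj : K j
      · have := hkk i j hij hi hj
        constructor <;> intro h' <;> linarith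
      · exact half i j hij hi hj
      · have h' := half j i hij.symm hj hi
        rw [add_comm (signVec I J j + k j) (signVec I J i + k i),
          add_comm (signVec I J j) (signVec I J i)] at h'
        exact h'
      · simp [hk0 i hi, hk0 j hj]) (by
      intro h0
      obtain ⟨u, hu⟩ := hne
      have := congrFun h0 u
      have hKu : ¬ K u := fun h => h.1 hu
      simp only [hk0 u hKu, add_zero, Pi.zero_apply] at this
      rcases Finset.mem_union.mp hu with h1 | h1
      · simp [signVec_of_mem_left hIJ h1] at this
      · simp [signVec_of_mem_right hIJ h1] at this)
  obtain ⟨⟨w, hw⟩, hwc⟩ := c.nonempty_supp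
  have hKw : K w := ⟨hw, hwc⟩
  have := congrFun hyz w
  simp only [Pi.smul_apply, smul_eq_mul, signVec_of_notMem hKw.1, zero_add] at this
  rcases hk1 w hKw with h2 | h2 <;> rw [h2] at this <;> linarith

/-- If the box has no point in the fibre over `s`, then one of the cut inequalities fails. -/
theorem exists_cut_lt (G : SimpleGraph V) [DecidableRel G.Adj]
    (hconn : G.Connected) (hnb : ¬ G.IsBipartite) (a b : G.edgeSet → ℝ) (hab : ∀ e, a e ≤ b e)
    (s : V → ℝ)
    (hs : ¬ ∃ x : G.edgeSet → ℝ, (∀ e, a e ≤ x e ∧ x e ≤ b e) ∧ incMap G x = s) :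
    ∃ I J : Finset V, Disjoint I J ∧ (crossSubgraph G I J).Connected ∧
      (∀ c : (G.induce {x | x ∉ I ∪ J}).ConnectedComponent, ¬ c.toSimpleGraph.IsBipartite) ∧
      boxSupport G a b (signVec I J) < ∑ v, s v * signVec I J v := by
  obtain ⟨y, hy, hel⟩ := exists_elementary_boxSupport_lt G hconn hnb a b s
    (exists_boxSupport_lt G a b hab s hs)
  have hy0 : y ≠ 0 := by
    rintro rfl
    simp [boxSupport, edgeSum] at hy
  have := hconn.nonempty
  obtain ⟨u, -, hu⟩ := Finset.exists_max_image Finset.univ (fun v => |y v|) Finset.univ_nonempty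
  set m := |y u|
  have hmax : ∀ v, |y v| ≤ m := fun v => hu v (Finset.mem_univ v)
  have hm : 0 < m := by
    obtain ⟨w, hw⟩ := Function.ne_iff.mp hy0
    exact (abs_pos.mpr hw).trans_le (hmax w)
  set I := Finset.univ.filter fun v => y v = m with hI
  set J := Finset.univ.filter fun v => y v = -m with hJ
  have hIJ : Disjoint I J := by
    rw [Finset.disjoint_left]
    intro v h1 h2
    simp only [hI, hJ, Finset.mem_filter, Finset.mem_univ, true_and] at h1 h2
    linarith
  have hne : (I ∪ J).Nonempty := by
    refine ⟨u, ?_⟩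
    rw [Finset.mem_union]
    rcases abs_choice (y u) with h | h
    · exact .inl (by simp [hI, m, h])
    · exact .inr (by simp [hJ, m, h])
  have hz0 : signVec I J ≠ 0 := by
    obtain ⟨w, hw⟩ := hne
    refine Function.ne_iff.mpr ⟨w, ?_⟩
    rcases Finset.mem_union.mp hw with h | h
    · simp [signVec_of_mem_left hIJ h]
    · simp [signVec_of_mem_right hIJ h]
  have hconf : EdgeConformal G (signVec I J) y := conformal_signVec_max G y m hmax
  obtain ⟨c, hc, hyc⟩ := hel _ hconf hz0
  have hel' : ∀ z, EdgeConformal G z (signVec I J) → z ≠ 0 → ∃ d : ℝ, 0 < d ∧ signVec I J = d • z := by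
    intro z hz hz0
    obtain ⟨d, hd, hyd⟩ := hel z (fun e => ⟨fun h => (hconf e).1 ((hz e).1 h),
      fun h => (hconf e).2 ((hz e).2 h)⟩) hz0
    refine ⟨c⁻¹ * d, by positivity, ?_⟩
    rw [mul_smul, ← hyd, hyc, smul_smul, inv_mul_cancel₀ hc.ne', one_smul]
  refine ⟨I, J, hIJ, crossSubgraph_connected_of_elementary G I J hIJ hne hel',
    component_not_bipartite_of_elementary G I J hIJ hne hel', ?_⟩
  have hsum : ∑ v, s v * y v = c * ∑ v, s v * signVec I J v := by
    rw [Finset.mul_sum, hyc]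
    exact Finset.sum_congr rfl fun v _ => by simp; ring
  rw [hsum, hyc, boxSupport_smul G a b _ c hc.le] at hy
  exact lt_of_mul_lt_mul_left hy hc.le

/-! ### Alternating sums and fractional edges -/

/-- The alternating sum of the edges of a walk. -/
noncomputable def altSum {V : Type*} [DecidableEq V] {G : SimpleGraph V} :
    ∀ {u v : V}, G.Walk u v → (G.edgeSet → ℝ)
  | _, _, .nil => 0
  | _, _, .cons (u := u) (v := v) h p => Pi.single ⟨s(u, v), h⟩ 1 - altSum p

/-- The integers as a subring of the reals. -/
abbrev realInts : Subring ℝ := (Int.castRingHom ℝ).range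

theorem mem_realInts {r : ℝ} : r ∈ realInts ↔ ∃ n : ℤ, (n : ℝ) = r := Iff.rfl

theorem intCast_mem_realInts (n : ℤ) : (n : ℝ) ∈ realInts := ⟨n, rfl⟩

/-- The graph of the edges on which `x` is not an integer. -/
def fracGraph {V : Type*} (G : SimpleGraph V) (x : G.edgeSet → ℝ) : SimpleGraph V where
  Adj u v := ∃ h : G.Adj u v, x ⟨s(u, v), h⟩ ∉ realInts
  symm := ⟨by
    rintro u v ⟨h, hx⟩
    refine ⟨h.symm, ?_⟩
    rwa [show (⟨s(v, u), h.symm⟩ : G.edgeSet) = ⟨s(u, v), h⟩ from Subtype.ext Sym2.eq_swap]⟩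
  loopless := ⟨fun u ⟨h, _⟩ => G.loopless.irrefl u h⟩

theorem fracGraph_le {V : Type*} (G : SimpleGraph V) (x : G.edgeSet → ℝ) : fracGraph G x ≤ G :=
  fun _ _ h => h.1

theorem mem_edgeSet_fracGraph {V : Type*} (G : SimpleGraph V) (x : G.edgeSet → ℝ)
    (e : G.edgeSet) : (e : Sym2 V) ∈ (fracGraph G x).edgeSet ↔ x e ∉ realInts := by
  obtain ⟨e, he⟩ := e
  induction e with
  | h i j => exact ⟨fun ⟨_, h⟩ => h, fun h => ⟨he, h⟩⟩

theorem altSum_eq_zero {V : Type*} [DecidableEq V] {G : SimpleGraph V} {u v : V} (p : G.Walk u v)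
    (e : G.edgeSet) (he : (e : Sym2 V) ∉ p.edges) : altSum p e = 0 := by
  induction p with
  | nil => rfl
  | @cons i j _ h p ih =>
    rw [SimpleGraph.Walk.edges_cons, List.mem_cons, not_or] at he
    have hne : e ≠ ⟨s(i, j), h⟩ := fun hh => he.1 (congrArg Subtype.val hh)
    simp [altSum, ih he.2, hne]

theorem altSum_of_isTrail {V : Type*} [DecidableEq V] {G : SimpleGraph V} {u v : V}
    (p : G.Walk u v) (hp : p.IsTrail) (e : G.edgeSet) (he : (e : Sym2 V) ∈ p.edges) :
    altSum p e = 1 ∨ altSum p e = -1 := by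
  induction p with
  | nil => simp at he
  | @cons i j _ h p ih =>
    rw [SimpleGraph.Walk.isTrail_cons] at hp
    rw [SimpleGraph.Walk.edges_cons, List.mem_cons] at he
    by_cases heq : (e : Sym2 V) ∈ p.edges
    · have hne : e ≠ ⟨s(i, j), h⟩ := by
        rintro rfl
        exact hp.2 heq
      rcases ih hp.1 heq with h' | h' <;> simp [altSum, hne, h']
    · have : e = ⟨s(i, j), h⟩ := Subtype.ext (he.resolve_right heq)
      subst this
      simp [altSum, altSum_eq_zero p _ heq]

theorem altSum_append {V : Type*} [DecidableEq V] {G : SimpleGraph V} {u v w : V}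
    (p : G.Walk u v) (q : G.Walk v w) :
    altSum (p.append q) = altSum p + (-1 : ℝ) ^ p.length • altSum q := by
  induction p with
  | nil => simp [altSum]
  | cons h p ih =>
    simp only [SimpleGraph.Walk.cons_append, altSum, ih, SimpleGraph.Walk.length_cons, pow_succ]
    module

theorem incMap_single (G : SimpleGraph V) [DecidableRel G.Adj] {u v : V} (h : G.Adj u v) :
    incMap G (Pi.single ⟨s(u, v), h⟩ 1) = Pi.single u 1 + Pi.single v 1 := by
  ext t
  simp only [incMap, LinearMap.coe_mk, AddHom.coe_mk, Pi.single_apply, ite_mul, one_mul, zero_mul,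
    Finset.sum_ite_eq', Finset.mem_univ, if_true, edgeVector, Sym2.lift_mk, Pi.add_apply]
  push_cast
  rfl

/-- Contributions at inner vertices telescope. Hence a closed walk of even length gives a kernel
vector, and one of odd length gives 2 at its base vertex and 0 elsewhere. -/
theorem incMap_altSum (G : SimpleGraph V) [DecidableRel G.Adj] {u v : V} (p : G.Walk u v) :
    incMap G (altSum p) = Pi.single u 1 - (-1 : ℝ) ^ p.length • Pi.single v 1 := by
  induction p with
  | nil => simp [altSum]
  | cons h p ih =>
    simp only [altSum, map_sub, incMap_single, ih, SimpleGraph.Walk.length_cons, pow_succ]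
    module

/-- The ends of a longest path are leaves. Two are needed so that one avoids a prescribed root. -/
theorem exists_ne_existsUnique_adj {V : Type*} [Finite V] (H : SimpleGraph V)
    (hH : H.IsAcyclic) (hne : ∃ u v, H.Adj u v) :
    ∃ u v, u ≠ v ∧ (∃! w, H.Adj u w) ∧ ∃! w, H.Adj v w := by
  obtain ⟨a, b, hab⟩ := hne
  have : Nonempty V := ⟨a⟩
  obtain ⟨u, v, p, hp, hmax⟩ := SimpleGraph.Walk.exists_isPath_forall_isPath_length_le_length H
  have h1 : 1 ≤ p.length := hmax a b hab.toWalk (by simp [SimpleGraph.Walk.isPath_def, hab.ne])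
  have hnil : ¬ p.Nil := by rw [← SimpleGraph.Walk.length_eq_zero_iff]; omega
  refine ⟨u, v, hp.nil_iff_eq.not.mp hnil, ⟨_, p.adj_snd hnil, fun w hadj => ?_⟩,
    ⟨_, (p.adj_penultimate hnil).symm, fun w hadj => ?_⟩⟩
  · apply hH.eq_snd_of_adj_start hp hadj
    have : ¬ (p.cons hadj.symm).IsPath := by grind [SimpleGraph.Walk.length_cons]
    grind [hp.cons]
  · apply hH.eq_penultimate_of_adj_end hp hadj
    have : ¬ (p.concat hadj).IsPath := by grind [SimpleGraph.Walk.length_concat]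
    grind [hp.concat]

theorem edgeVector_eq_zero {V : Type*} [DecidableEq V] (e : Sym2 V) (v : V) (hv : v ∉ e) :
    edgeVector e v = 0 := by
  induction e with
  | h i j =>
    simp only [Sym2.mem_iff, not_or] at hv
    simp [edgeVector, hv.1, hv.2]

theorem edgeVector_eq_one {V : Type*} [DecidableEq V] (v w : V) (hvw : v ≠ w) :
    edgeVector s(v, w) v = 1 := by
  simp [edgeVector, hvw]

/-- If the fractional edges form a forest and the vertex sums are integers away from a root,
then all weights are integers. -/
theorem mem_realInts_of_fracGraph_isAcyclic (G : SimpleGraph V) [DecidableRel G.Adj]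
    (x : G.edgeSet → ℝ) (r : V) (hr : ∀ v, v ≠ r → incMap G x v ∈ realInts)
    (hac : (fracGraph G x).IsAcyclic) (e : G.edgeSet) : x e ∈ realInts := by
  by_contra he
  have hne : ∃ u v, (fracGraph G x).Adj u v := by
    obtain ⟨e, hG⟩ := e
    induction e with
    | h i j => exact ⟨i, j, hG, he⟩
  obtain ⟨u, v, huv, hu, hv⟩ := exists_ne_existsUnique_adj _ hac hne
  obtain ⟨l, hl, w, ⟨hlw, hx⟩, huniq⟩ : ∃ l, l ≠ r ∧ ∃! w, (fracGraph G x).Adj l w := by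
    by_cases h : u = r
    · exact ⟨v, fun h' => huv (h.trans h'.symm), hv⟩
    · exact ⟨u, h, hu⟩
  refine hx ?_
  have hsum := hr l hl
  simp only [incMap, LinearMap.coe_mk, AddHom.coe_mk] at hsum
  rw [← Finset.add_sum_erase _ _ (Finset.mem_univ ⟨s(l, w), hlw⟩),
    edgeVector_eq_one _ _ hlw.ne] at hsum
  rw [Int.cast_one, mul_one] at hsum
  -- At the leaf `l` all other incident edges have integral weight, so the integral vertex sum makes
  -- the last weight integral too.
  refine (add_mem_cancel_right (sum_mem fun e' he' => ?_)).mp hsum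
  rw [Finset.mem_erase] at he'
  obtain ⟨e', hG'⟩ := e'
  by_cases hle : l ∈ e'
  · obtain ⟨w', rfl⟩ := hle
    refine mul_mem ?_ (intCast_mem_realInts _)
    by_contra hx'
    have : w' = w := huniq w' ⟨hG', hx'⟩
    subst this
    exact he'.1 rfl
  · simp [edgeVector_eq_zero _ _ hle]

/-- Move along `w` until the first coordinate reaches an integer; `τ e` is the time at which
coordinate `e` would do so. -/
theorem exists_shift_mem_realInts {ι : Type*} [Fintype ι] (x w : ι → ℝ) (hw : w ≠ 0)
    (hsupp : ∀ e, w e ≠ 0 → x e ∉ realInts) :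
    ∃ t : ℝ, (∀ e, (⌊x e⌋ : ℝ) ≤ x e + t * w e ∧ x e + t * w e ≤ ⌈x e⌉) ∧
      ∃ e, x e ∉ realInts ∧ x e + t * w e ∈ realInts := by
  classical
  obtain ⟨e₁, he₁⟩ := Function.ne_iff.mp hw
  set τ : ι → ℝ := fun e => if 0 < w e then (⌈x e⌉ - x e) / w e else (⌊x e⌋ - x e) / w e with hτ
  obtain ⟨e₀, he₀, hmin⟩ := Finset.exists_min_image (Finset.univ.filter fun e => w e ≠ 0)
    τ ⟨e₁, by simpa using he₁⟩
  simp only [Finset.mem_filter, Finset.mem_univ, true_and] at he₀ hmin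
  have hnonneg : 0 ≤ τ e₀ := by
    simp only [hτ]
    split_ifs with h
    · exact div_nonneg (sub_nonneg.mpr (Int.le_ceil _)) h.le
    · exact div_nonneg_of_nonpos (sub_nonpos.mpr (Int.floor_le _)) (not_lt.mp h)
  refine ⟨τ e₀, fun e => ?_, e₀, hsupp e₀ he₀, ?_⟩
  · rcases lt_trichotomy (w e) 0 with h | h | h
    · have h1 := hmin e h.ne
      have h2 : τ e = (⌊x e⌋ - x e) / w e := if_neg h.not_gt
      rw [h2, le_div_iff_of_neg h] at h1
      have := mul_nonpos_of_nonneg_of_nonpos hnonneg h.le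
      exact ⟨by linarith, by linarith [Int.le_ceil (x e)]⟩
    · rw [h, mul_zero, add_zero]
      exact ⟨Int.floor_le _, Int.le_ceil _⟩
    · have h1 := hmin e h.ne'
      have h2 : τ e = (⌈x e⌉ - x e) / w e := if_pos h
      rw [h2, le_div_iff₀ h] at h1
      have := mul_nonneg hnonneg h.le
      exact ⟨by linarith [Int.floor_le (x e)], by linarith⟩
  · simp only [hτ]
    split_ifs with h
    · rw [div_mul_cancel₀ _ he₀]
      exact ⟨⌈x e₀⌉, by simp⟩
    · rw [div_mul_cancel₀ _ he₀]
      exact ⟨⌊x e₀⌋, by simp⟩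

/-- A solution whose fractional part supports no kernel vector. -/
theorem exists_fractional_kernel_free (G : SimpleGraph V) [DecidableRel G.Adj]
    (a b : G.edgeSet → ℤ) (s : V → ℝ)
    (hex : ∃ x : G.edgeSet → ℝ, (∀ e, (a e : ℝ) ≤ x e ∧ x e ≤ b e) ∧ incMap G x = s) :
    ∃ x : G.edgeSet → ℝ, ((∀ e, (a e : ℝ) ≤ x e ∧ x e ≤ b e) ∧ incMap G x = s) ∧
      ∀ w : G.edgeSet → ℝ, incMap G w = 0 → (∀ e, w e ≠ 0 → x e ∉ realInts) → w = 0 := by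
  classical
  obtain ⟨x, ⟨hx, hxs⟩, hmin⟩ := WellFounded.has_min
    (measure fun x : G.edgeSet → ℝ => (Finset.univ.filter fun e => x e ∉ realInts).card).wf
    {x | (∀ e, (a e : ℝ) ≤ x e ∧ x e ≤ b e) ∧ incMap G x = s} hex
  refine ⟨x, ⟨hx, hxs⟩, fun w hw hsupp => ?_⟩
  by_contra hw0
  obtain ⟨t, ht, e₀, he₀, he₀'⟩ := exists_shift_mem_realInts x w hw0 hsupp
  refine hmin (x + t • w) ⟨fun e => ⟨?_, ?_⟩, ?_⟩ (Finset.card_lt_card ?_)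
  -- Since `a` and `b` are integral, staying between floor and ceiling keeps the point in the box.
  · exact le_trans (by exact_mod_cast Int.le_floor.mpr (hx e).1) (ht e).1
  · exact le_trans (ht e).2 (by exact_mod_cast Int.ceil_le.mpr (hx e).2)
  · rw [map_add, map_smul, hw, smul_zero, add_zero, hxs]
  · refine (Finset.ssubset_iff_of_subset ?_).mpr ⟨e₀, by simpa using he₀, ?_⟩
    · intro e he
      simp only [Finset.mem_filter, Finset.mem_univ, true_and] at he ⊢
      intro hxe
      have : w e = 0 := by
        by_contra h
        exact hsupp e h hxe
      exact he (by simpa [this] using hxe)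
    · simpa using he₀'

/-- Integrality: if any two odd cycles meet and `∑ s` is even, a real solution in an integral box
yields an integral one. -/
theorem exists_integral_solution (G : SimpleGraph V) [DecidableRel G.Adj]
    (hmeet : ∀ (c d : V) (C : G.Walk c c) (D : G.Walk d d), C.IsCycle → Odd C.length →
      D.IsCycle → Odd D.length → ∃ w, w ∈ C.support ∧ w ∈ D.support)
    (a b : G.edgeSet → ℤ) (s : V → ℤ) (heven : Even (∑ v, s v))
    (hex : ∃ x : G.edgeSet → ℝ, (∀ e, (a e : ℝ) ≤ x e ∧ x e ≤ b e) ∧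
      incMap G x = fun v => (s v : ℝ)) :
    ∃ x : G.edgeSet → ℝ, (∀ e, (a e : ℝ) ≤ x e ∧ x e ≤ b e) ∧
      (incMap G x = fun v => (s v : ℝ)) ∧ ∀ e, x e ∈ realInts := by
  obtain ⟨x, ⟨hx, hxs⟩, hker⟩ := exists_fractional_kernel_free G a b _ hex
  refine ⟨x, hx, hxs, ?_⟩
  have hxv : ∀ v, incMap G x v ∈ realInts := fun v => by
    rw [hxs]; exact intCast_mem_realInts _
  by_cases hac : (fracGraph G x).IsAcyclic
  · intro e
    obtain ⟨e', he'⟩ := e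
    induction e' with
    | h i j => exact mem_realInts_of_fracGraph_isAcyclic G x i (fun v _ => hxv v) hac _
  have hclosed : ∀ (u : V) (p : G.Walk u u), Even p.length →
      (∀ e ∈ p.edges, e ∈ (fracGraph G x).edgeSet) → altSum p = 0 := by
    intro u p hp hpe
    refine hker _ ?_ fun e he => ?_
    · rw [incMap_altSum, hp.neg_one_pow, one_smul, sub_self]
    · rw [← mem_edgeSet_fracGraph]
      exact hpe _ (by_contra fun h => he (altSum_eq_zero p e h))
  have hcyc : ∀ (u : V) (C : G.Walk u u), C.IsCycle →
      (∀ e ∈ C.edges, e ∈ (fracGraph G x).edgeSet) → Odd C.length := by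
    intro u C hC hCe
    by_contra hodd
    have h0 := hclosed u C (Nat.not_odd_iff_even.mp hodd) hCe
    cases C with
    | nil => exact hC.ne_nil rfl
    | @cons _ j _ h p =>
      rcases altSum_of_isTrail _ hC.isTrail ⟨s(u, j), h⟩ (by simp) with h' | h' <;>
        rw [h0] at h' <;> norm_num at h'
  simp only [SimpleGraph.IsAcyclic, not_forall, not_not] at hac
  obtain ⟨u, C', hC'⟩ := hac
  set C := C'.mapLe (fracGraph_le G x) with hCdef
  have hC : C.IsCycle := hC'.mapLe _
  have hCe : ∀ e ∈ C.edges, e ∈ (fracGraph G x).edgeSet := by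
    intro e he
    rw [hCdef, SimpleGraph.Walk.edges_mapLe_eq_edges] at he
    exact C'.edges_subset_edgeSet he
  have hCodd := hcyc u C hC hCe
  obtain ⟨e₀, he₀⟩ : ∃ e : G.edgeSet, (e : Sym2 V) ∈ C.edges := by
    cases hc : C with
    | nil => exact absurd hc hC.ne_nil
    | @cons _ j _ h p => exact ⟨⟨s(u, j), h⟩, by simp⟩
  -- The shift removes `e₀` from the fractional edges. The shifted `y` may leave the box, but only
  -- its integrality matters.
  obtain ⟨t, ht⟩ : ∃ t : ℝ, x e₀ + t * altSum C e₀ = 0 := by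
    rcases altSum_of_isTrail C hC.isTrail e₀ he₀ with h | h
    · exact ⟨-x e₀, by rw [h]; ring⟩
    · exact ⟨x e₀, by rw [h]; ring⟩
  set y : G.edgeSet → ℝ := x + t • altSum C with hy
  have hye₀ : y e₀ = 0 := by simpa [hy] using ht
  have hle : ∀ e : G.edgeSet, y e ∉ realInts → x e ∉ realInts := by
    intro e hye
    by_cases he : (e : Sym2 V) ∈ C.edges
    · exact (mem_edgeSet_fracGraph G x e).mp (hCe _ he)
    · simpa [hy, altSum_eq_zero C e he] using hye
  have hyinc : incMap G y = (fun v => (s v : ℝ)) + (2 * t) • Pi.single u 1 := by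
    rw [hy, map_add, map_smul, hxs, incMap_altSum, hCodd.neg_one_pow]
    module
  have hyac : (fracGraph G y).IsAcyclic := by
    intro v D' hD'
    have hyx : fracGraph G y ≤ fracGraph G x := fun i j ⟨h, h'⟩ => ⟨h, hle _ h'⟩
    set D := D'.mapLe (fracGraph_le G y) with hDdef
    have hD : D.IsCycle := hD'.mapLe _
    have hDe : ∀ e ∈ D.edges, e ∈ (fracGraph G y).edgeSet := by
      intro e he
      rw [hDdef, SimpleGraph.Walk.edges_mapLe_eq_edges] at he
      exact D'.edges_subset_edgeSet he
    have hDe' : ∀ e ∈ D.edges, e ∈ (fracGraph G x).edgeSet := fun e he =>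
      SimpleGraph.edgeSet_mono hyx (hDe e he)
    have hDodd := hcyc v D hD hDe'
    have he₀D : (e₀ : Sym2 V) ∉ D.edges := by
      intro h
      refine (mem_edgeSet_fracGraph G y e₀).mp (hDe _ h) ?_
      rw [hye₀]
      exact zero_mem _
    -- Joined at `w`, the two odd cycles form an even closed walk, whose alternating sum must
    -- vanish; yet at `e₀`, which lies on `C` only, it is ±1.
    obtain ⟨w, hwC, hwD⟩ := hmeet u v C D hC hCodd hD hDodd
    have hCr : ∀ e, e ∈ (C.rotate w hwC).edges ↔ e ∈ C.edges := fun e =>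
      (C.rotate_edges w hwC).mem_iff
    have hDr : ∀ e, e ∈ (D.rotate w hwD).edges ↔ e ∈ D.edges := fun e =>
      (D.rotate_edges w hwD).mem_iff
    have h0 := hclosed w ((C.rotate w hwC).append (D.rotate w hwD))
      (by
        rw [SimpleGraph.Walk.length_append, SimpleGraph.Walk.length_rotate,
          SimpleGraph.Walk.length_rotate]
        exact hCodd.add_odd hDodd)
      (by
        intro e he
        rw [SimpleGraph.Walk.edges_append, List.mem_append, hCr, hDr] at he
        exact he.elim (hCe e) (hDe' e))
    have h1 := congrFun h0 e₀
    rw [altSum_append, Pi.add_apply, Pi.smul_apply,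
      altSum_eq_zero (D.rotate w hwD) e₀ (by rwa [hDr]), smul_zero, add_zero] at h1
    rcases altSum_of_isTrail (C.rotate w hwC) (hC.rotate hwC).isTrail e₀ (by rwa [hCr])
      with h' | h' <;> rw [h'] at h1 <;> norm_num at h1
  have hyint : ∀ e, y e ∈ realInts := mem_realInts_of_fracGraph_isAcyclic G y u (by
    intro v hv
    rw [hyinc]
    simp [hv]) hyac
  -- Summing all vertex sums of `y` counts every edge twice: 2 ∑ y = ∑ s + 2t, and ∑ s is even.
  have htint : t ∈ realInts := by
    have h1 := sum_mul_incMap G y (fun _ => 1)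
    have h2 : ∀ e : G.edgeSet, edgeSum (fun _ => 1) (e : Sym2 V) = 2 := by
      rintro ⟨e, he⟩
      induction e with
      | h i j => rw [edgeSum_mk]; norm_num
    simp only [h2, hyinc, mul_one, Pi.add_apply, Pi.smul_apply, Finset.sum_add_distrib,
      Pi.single_apply, smul_eq_mul, mul_ite, mul_zero, Finset.sum_ite_eq', Finset.mem_univ,
      if_true, ← Finset.sum_mul] at h1
    obtain ⟨k, hk⟩ := heven
    have h3 : ∑ v, (s v : ℝ) = k + k := by exact_mod_cast hk
    have h4 : t = ∑ e, y e - k := by linarith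
    rw [h4]
    exact sub_mem (sum_mem fun e _ => hyint e) (intCast_mem_realInts k)
  intro e
  by_contra hxe
  refine hxe ?_
  have : x e = y e - t * altSum C e := by simp [hy]
  rw [this]
  refine sub_mem (hyint e) (mul_mem htint ?_)
  by_cases he : (e : Sym2 V) ∈ C.edges
  · rcases altSum_of_isTrail C hC.isTrail e he with h | h <;> rw [h]
    · exact one_mem _
    · exact neg_mem (one_mem _)
  · rw [altSum_eq_zero C e he]
    exact zero_mem _

/-! ### Disjoint odd cycles -/

/-- In a connected graph, vertex-disjoint odd cycles are joined by a path. -/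
theorem hasConnectedOddCycles_of_disjoint {V : Type*} [Finite V] (G : SimpleGraph V)
    (hconn : G.Connected) {c d : V} (C : G.Walk c c) (D : G.Walk d d) (hC : C.IsCycle)
    (hCo : Odd C.length) (hD : D.IsCycle) (hDo : Odd D.length)
    (hdisj : ∀ w ∈ C.support, w ∉ D.support) : HasConnectedOddCycles G := by
  classical
  -- For a closest pair `u`, `v`, a shortest path meets the cycles only at its ends: any other
  -- meeting point would give a closer pair.
  obtain ⟨⟨u, v⟩, ⟨hu, hv⟩, hmin⟩ := WellFounded.has_min
    (measure fun p : V × V => G.dist p.1 p.2).wf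
    {p : V × V | p.1 ∈ C.support ∧ p.2 ∈ D.support}
    ⟨(c, d), C.start_mem_support, D.start_mem_support⟩
  obtain ⟨P, hP, hPl⟩ := hconn.exists_path_of_dist u v
  have hmin' : ∀ x y, x ∈ C.support → y ∈ D.support → P.length ≤ G.dist x y := by
    intro x y hx hy
    rw [hPl]
    exact not_lt.mp (hmin (x, y) ⟨hx, hy⟩)
  refine ⟨c, d, u, v, C, D, P, hC, hCo, hD, hDo, ?_, hP, ?_, hu, hv, ?_, ?_⟩
  · intro e he he'
    induction e with
    | h i j =>
      exact hdisj i (C.fst_mem_support_of_mem_edges he) (D.fst_mem_support_of_mem_edges he')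
  · rintro rfl
    exact hdisj _ hu hv
  · intro x hxP hxC
    by_contra hne
    have h1 := SimpleGraph.Walk.length_dropUntil_lt_length hxP hne
    have h2 := hmin' x v hxC hv
    have h3 := SimpleGraph.dist_le (P.dropUntil x hxP)
    omega
  · intro x hxP hxD
    by_contra hne
    have h1 := SimpleGraph.Walk.length_takeUntil_lt_length hxP hne
    have h2 := hmin' u x hu hxD
    have h3 := SimpleGraph.dist_le (P.takeUntil x hxP)
    omega

/-! ### The cut inequalities over the integers -/

theorem mem_edgesBetween_mk (G : SimpleGraph V) [DecidableRel G.Adj] (A B : Finset V) {i j : V}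
    (h : s(i, j) ∈ G.edgeSet) : (⟨s(i, j), h⟩ : G.edgeSet) ∈ edgesBetween G A B ↔
      (i ∈ A ∧ j ∈ B) ∨ (j ∈ A ∧ i ∈ B) := by
  simp only [edgesBetween, Finset.mem_filter, Finset.mem_univ, true_and]
  constructor
  · rintro ⟨i', hi', j', hj', he⟩
    rcases Sym2.eq_iff.mp he with ⟨rfl, rfl⟩ | ⟨rfl, rfl⟩
    · exact .inl ⟨hi', hj'⟩
    · exact .inr ⟨hi', hj'⟩
  · rintro (⟨hi, hj⟩ | ⟨hj, hi⟩)
    · exact ⟨i, hi, j, hj, rfl⟩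
    · exact ⟨j, hj, i, hi, Sym2.eq_swap⟩

/-- The edge sum of the sign vector is ±2 inside I or J, ±1 from I or J to the outside, and 0 on all
other edges; positive sums select b and negative ones a. -/
theorem boxSupport_signVec (G : SimpleGraph V) [DecidableRel G.Adj] (a b : G.edgeSet → ℤ)
    (I J : Finset V) (hIJ : Disjoint I J) :
    boxSupport G (fun e => (a e : ℝ)) (fun e => (b e : ℝ)) (signVec I J) =
      ((∑ e ∈ edgesBetween G I (I ∪ J)ᶜ, b e + 2 * ∑ e ∈ edgesBetween G I I, b e
        - ∑ e ∈ edgesBetween G J (I ∪ J)ᶜ, a e - 2 * ∑ e ∈ edgesBetween G J J, a e : ℤ) : ℝ) := by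
  push_cast
  have hsum : ∀ (S : Finset G.edgeSet) (f : G.edgeSet → ℤ),
      ∑ e ∈ S, (f e : ℝ) = ∑ e, if e ∈ S then (f e : ℝ) else 0 := fun S f => by
    rw [← Finset.sum_filter]; simp
  simp only [hsum, boxSupport, Finset.mul_sum, ← Finset.sum_add_distrib, ← Finset.sum_sub_distrib]
  refine Finset.sum_congr rfl ?_
  rintro ⟨e, he⟩ -
  induction e with
  | h i j =>
    simp only [mem_edgesBetween_mk, edgeSum_mk, Finset.mem_compl, Finset.mem_union, signVec]
    have hi : ¬ (i ∈ I ∧ i ∈ J) := fun h => Finset.disjoint_left.mp hIJ h.1 h.2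
    have hj : ¬ (j ∈ I ∧ j ∈ J) := fun h => Finset.disjoint_left.mp hIJ h.1 h.2
    by_cases h1 : i ∈ I <;> by_cases h2 : i ∈ J <;> by_cases h3 : j ∈ I <;>
      by_cases h4 : j ∈ J <;> simp only [h1, h2, h3, h4, and_self, not_true] at hi hj <;>
      simp only [h1, h2, h3, h4] <;> norm_num <;> try ring

theorem sum_mul_signVec (s : V → ℤ) (I J : Finset V) :
    ∑ v, (s v : ℝ) * signVec I J v = ((∑ i ∈ I, s i - ∑ j ∈ J, s j : ℤ) : ℝ) := by
  simp [signVec, mul_sub, Finset.sum_sub_distrib]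

theorem incMap_intCast (G : SimpleGraph V) [DecidableRel G.Adj] (x : G.edgeSet → ℤ) (v : V) :
    incMap G (fun e => (x e : ℝ)) v =
      (((∑ e : G.edgeSet, x e • edgeVector (e : Sym2 V)) v : ℤ) : ℝ) := by
  simp [incMap, Finset.sum_apply]

theorem even_sum_of_eq_sum_edgeVector (G : SimpleGraph V) [DecidableRel G.Adj]
    (x : G.edgeSet → ℤ) : Even (∑ v, (∑ e : G.edgeSet, x e • edgeVector (e : Sym2 V)) v) := by
  simp only [Finset.sum_apply, Pi.smul_apply, smul_eq_mul]
  rw [Finset.sum_comm]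
  refine Finset.even_sum _ fun e _ => ?_
  rw [← Finset.mul_sum]
  refine Even.mul_left ?_ _
  obtain ⟨e, he⟩ := e
  induction e with
  | h i j => simp [edgeVector, Finset.sum_add_distrib]

end

theorem theorem4p4 {V : Type*} [Fintype V] [DecidableEq V] (G : SimpleGraph V)
    [DecidableRel G.Adj] (hconn : G.Connected) (hnb : ¬ G.IsBipartite)
    (hodd : ¬ HasConnectedOddCycles G)
    (s : V → ℤ) (a b : G.edgeSet → ℤ) (hab : ∀ e, a e ≤ b e) :
    (∃ x : G.edgeSet → ℤ, (∀ e, a e ≤ x e ∧ x e ≤ b e) ∧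
        s = ∑ e : G.edgeSet, x e • edgeVector (e : Sym2 V)) ↔
      Even (∑ i, s i) ∧
      ∀ I J : Finset V, Disjoint I J →
        (crossSubgraph G I J).Connected →
        (∀ c : (G.induce {x | x ∉ I ∪ J}).ConnectedComponent,
          ¬ c.toSimpleGraph.IsBipartite) →
        ∑ i ∈ I, s i - ∑ j ∈ J, s j ≤
          ∑ e ∈ edgesBetween G I (I ∪ J)ᶜ, b e + 2 * ∑ e ∈ edgesBetween G I I, b e
            - ∑ e ∈ edgesBetween G J (I ∪ J)ᶜ, a e - 2 * ∑ e ∈ edgesBetween G J J, a e := by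
  constructor
  · rintro ⟨x, hx, rfl⟩
    refine ⟨even_sum_of_eq_sum_edgeVector G x, fun I J hIJ _ _ => ?_⟩
    rw [← Int.cast_le (R := ℝ), ← boxSupport_signVec G a b I J hIJ, ← sum_mul_signVec]
    simp only [← incMap_intCast]
    rw [sum_mul_incMap]
    exact le_boxSupport G _ _ _ (fun e => by exact_mod_cast hx e) _
  · rintro ⟨heven, hcut⟩
    have hreal : ∃ x : G.edgeSet → ℝ, (∀ e, (a e : ℝ) ≤ x e ∧ x e ≤ b e) ∧
        incMap G x = fun v => (s v : ℝ) := by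
      by_contra hno
      obtain ⟨I, J, hIJ, h1, h2, h3⟩ := exists_cut_lt G hconn hnb (fun e => (a e : ℝ))
        (fun e => (b e : ℝ)) (fun e => by exact_mod_cast hab e) (fun v => (s v : ℝ)) hno
      rw [boxSupport_signVec G a b I J hIJ, sum_mul_signVec, Int.cast_lt] at h3
      exact absurd (hcut I J hIJ h1 h2) (not_le.mpr h3)
    have hmeet : ∀ (c d : V) (C : G.Walk c c) (D : G.Walk d d), C.IsCycle → Odd C.length →
        D.IsCycle → Odd D.length → ∃ w, w ∈ C.support ∧ w ∈ D.support := by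
      intro c d C D hC hCo hD hDo
      by_contra! hcon
      exact hodd (hasConnectedOddCycles_of_disjoint G hconn C D hC hCo hD hDo hcon)
    obtain ⟨x, hx, hxs, hint⟩ := exists_integral_solution G hmeet a b s heven hreal
    choose n hn using fun e => mem_realInts.mp (hint e)
    obtain rfl : (fun e => (n e : ℝ)) = x := funext hn
    refine ⟨n, fun e => ⟨Int.cast_le.mp (hx e).1, Int.cast_le.mp (hx e).2⟩, ?_⟩
    ext v
    have := congrFun hxs v
    rw [incMap_intCast] at this
    exact_mod_cast this.symm
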